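/- Let $K$ be a compact metric space. Let $C(K)$ be the space of continuous functions $K\to\mathbb R$, and let $B_1(K)$ be the set of bounded Baire-1 functions on $K$, that is, of the pointwise limits of uniformly bounded, pointwise convergent sequences in $C(K)$. For $0\le C<\infty$ say that $G:K\to\mathbb R$ has variation bound $C$ if there is a sequence $(f_n)_{n\ge 0}\subseteq C(K)$ with $f_0\equiv 0$, converging pointwise to $G$, such that $$\sum_{n=0}^\infty |f_{n+1}(k)-f_n(k)|\le C\quad\text{for all }k\in K .$$ Let $DBSC(K)$ be the set of functions that have a finite variation bound and, for $G\in DBSC(K)$, let $|G|_D$ be the infimum of the variation bounds of $G$. Let $B_{1/4}(K)$ be the set of those $F\in B_1(K)$ for which there is a sequence $(F_n)\subseteq DBSC(K)$ converging uniformly to $F$ with $\sup_n|F_n|_D<\infty$. **Theorem 6.1.** Let $K$ be a compact metric space and let $F\in B_1(K)$. Then $F\in B_{1/4}(K)$ if and only if there exists $C<\infty$ such that for every $\varepsilon>0$ there exists a sequence $(S_n)_{n=0}^\infty\subseteq C(K)$ with $S_0\equiv 0$ and $S_n(k)\to F(k)$ for all $k\in K$, such that for every strictly increasing sequence $(n_i)_{i\ge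 0}$ in $\{0,1,2,\dots\}$ and every $k\in K$, $$\sum_{j\in B((n_i),k)} |S_{n_{j+1}}(k)-S_{n_j}(k)|\le C,\qquad\text{where } B((n_i),k)=\{j\ge 0: |S_{n_{j+1}}(k)-S_{n_j}(k)|\ge\varepsilon\}.$$ -/

import Mathlib

open Filter Topology
open scoped NNReal ENNReal

section BaireClasses

variable {K : Type*} [TopologicalSpace K]

/-- `B₁(K)`: the bounded Baire-1 functions on `K`, i.e. the pointwise limits of uniformly bounded
sequences of continuous real functions on `K`. -/
def BaireOne (K : Type*) [TopologicalSpace K] : Set (K → ℝ) :=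
  {F | ∃ f : ℕ → C(K, ℝ), (∃ M : ℝ, ∀ n k, |f n k| ≤ M) ∧
    ∀ k, Tendsto (fun n => f n k) atTop (𝓝 (F k))}

/-- `F` is the pointwise limit of a sequence `(fₙ)` in `C(K)` with `f₀ = 0` and
`∑ₙ |fₙ₊₁(k) - fₙ(k)| ≤ C` for all `k`. The sum is taken in `[0, ∞]`, so the inequality includes the
convergence of the series. -/
def HasVariationBound (F : K → ℝ) (C : ℝ≥0) : Prop :=
  ∃ f : ℕ → C(K, ℝ), f 0 = 0 ∧
    (∀ k, Tendsto (fun n => f n k) atTop (𝓝 (F k))) ∧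
    ∀ k, ∑' n, ENNReal.ofReal |f (n + 1) k - f n k| ≤ (C : ℝ≥0∞)

/-- `DBSC(K)`: the differences of bounded semicontinuous functions on `K`. -/
def DBSC (K : Type*) [TopologicalSpace K] : Set (K → ℝ) :=
  {F | ∃ C : ℝ≥0, HasVariationBound F C}

/-- The norm `|F|_D` of a function `F` in `DBSC(K)` (it is used for such functions only). -/
noncomputable def dbscNorm (F : K → ℝ) : ℝ≥0 :=
  sInf {C : ℝ≥0 | HasVariationBound F C}

/-- `B_{1/4}(K)`: the functions in `B₁(K)` that are uniform limits of sequences in `DBSC(K)` which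
are bounded in the norm `|·|_D`. -/
def BaireQuarter (K : Type*) [TopologicalSpace K] : Set (K → ℝ) :=
  {F | F ∈ BaireOne K ∧ ∃ G : ℕ → K → ℝ, (∀ n, G n ∈ DBSC K) ∧
    TendstoUniformly G F atTop ∧ BddAbove (Set.range fun n => dbscNorm (G n))}

/-- `B((nᵢ), k)`: the set of the indices `j` with `|S_{n_{j+1}}(k) - S_{n_j}(k)| ≥ ε`. -/
def jumpSet (S : ℕ → C(K, ℝ)) (ε : ℝ) (n : ℕ → ℕ) (k : K) : Set ℕ :=
  {j | ε ≤ |S (n (j + 1)) k - S (n j) k|}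

end BaireClasses

/-! Given `S` with jump bound `C` at level `ε`, let `W n` be the largest total excess over `ε` of
the jumps along chains from `0` to `n`. Counting `(|jump| - ε)⁺` instead of whole jumps keeps `W n`
continuous. `W` increases, stays below `C`, and `|S n - S m| ≤ ε + (W n - W m)` for `m ≤ n`. So `S +
W` never drops by more than `ε`, and its running maximum `A` stays within `ε` of it; `A - W` then
has bounded variation and its limit is `ε`-close to `F` (`exists_hasVariationBound_of_jumps`).
Conversely, take `g` of bounded variation whose limit is `ε/4`-close to `F`, and correct it by at
most `ε/4` to converge to `F`: large jumps of the result come from comparable jumps of `g`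
(`tsum_jumpSet_le`). -/

section Variation

variable {K : Type*} [TopologicalSpace K]

/-- The largest sum `∑ (|S_{n_{j+1}} - S_{n_j}| - ε)⁺` along the chains `n₀ < ⋯ < n_r` from `0`
to `n`. -/
noncomputable def excessVariation (S : ℕ → C(K, ℝ)) (ε : ℝ) : ℕ → C(K, ℝ)
  | 0 => 0
  | n + 1 => (Finset.univ : Finset (Fin (n + 1))).sup' Finset.univ_nonempty fun m =>
      excessVariation S ε m + (|S (n + 1) - S m| - ContinuousMap.const K ε) ⊔ 0
decreasing_by exact m.2

theorem excessVariation_zero (S : ℕ → C(K, ℝ)) (ε : ℝ) : excessVariation S ε 0 = 0 := by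
  rw [excessVariation]

theorem excessVariation_succ_apply (S : ℕ → C(K, ℝ)) (ε : ℝ) (n : ℕ) (k : K) :
    excessVariation S ε (n + 1) k =
      (Finset.univ : Finset (Fin (n + 1))).sup' Finset.univ_nonempty fun m =>
        excessVariation S ε m k + max (|S (n + 1) k - S m k| - ε) 0 := by
  rw [excessVariation, ContinuousMap.sup'_apply]
  rfl

theorem excessVariation_add_le (S : ℕ → C(K, ℝ)) (ε : ℝ) {m n : ℕ} (h : m < n) (k : K) :
    excessVariation S ε m k + max (|S n k - S m k| - ε) 0 ≤ excessVariation S ε n k := by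
  obtain ⟨n, rfl⟩ : ∃ l, n = l + 1 := ⟨n - 1, by omega⟩
  rw [excessVariation_succ_apply]
  exact Finset.le_sup' (fun i : Fin (n + 1) =>
    excessVariation S ε i k + max (|S (n + 1) k - S i k| - ε) 0)
    (Finset.mem_univ (⟨m, h⟩ : Fin (n + 1)))

theorem monotone_excessVariation (S : ℕ → C(K, ℝ)) (ε : ℝ) (k : K) :
    Monotone fun n => excessVariation S ε n k :=
  monotone_nat_of_le_succ fun n =>
    (le_add_of_nonneg_right (le_max_right _ _)).trans
      (excessVariation_add_le S ε n.lt_succ_self k)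

theorem abs_sub_le_excessVariation (S : ℕ → C(K, ℝ)) {ε : ℝ} (hε : 0 ≤ ε) {m n : ℕ} (h : m ≤ n)
    (k : K) :
    |S n k - S m k| ≤ ε + (excessVariation S ε n k - excessVariation S ε m k) := by
  rcases h.eq_or_lt with rfl | h
  · simpa using hε
  · linarith [excessVariation_add_le S ε h k, le_max_left (|S n k - S m k| - ε) 0]

theorem exists_chain_excessVariation (S : ℕ → C(K, ℝ)) (ε : ℝ) (k : K) (n : ℕ) :
    ∃ (c : ℕ → ℕ) (r : ℕ), StrictMono c ∧ c r = n ∧ excessVariation S ε n k =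
      ∑ j ∈ Finset.range r, max (|S (c (j + 1)) k - S (c j) k| - ε) 0 := by
  induction n using Nat.strong_induction_on with
  | _ n ih =>
  cases n with
  | zero => exact ⟨id, 0, strictMono_id, rfl, by simp [excessVariation_zero]⟩
  | succ n =>
    obtain ⟨m, -, hm⟩ := Finset.exists_mem_eq_sup' (s := (Finset.univ : Finset (Fin (n + 1))))
      Finset.univ_nonempty fun m =>
        excessVariation S ε m k + max (|S (n + 1) k - S m k| - ε) 0
    obtain ⟨c, r, hc, hcr, hsum⟩ := ih m m.2
    -- After `m = c r` the sequence runs `n + 1, n + 2, …`; only its first term matters, the rest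
    -- makes it an infinite sequence.
    refine ⟨fun j => if j ≤ r then c j else n + (j - r), r + 1, ?_, by simp, ?_⟩
    · refine strictMono_nat_of_lt_succ fun j => ?_
      have hm2 := m.2
      rcases lt_trichotomy j r with h | rfl | h
      · simpa [h.le, Nat.succ_le_iff.2 h] using hc j.lt_succ_self
      · simp only [le_refl, if_true]
        rw [if_neg (by omega)]
        omega
      · simp only [if_neg (show ¬ j ≤ r by omega), if_neg (show ¬ j + 1 ≤ r by omega)]
        omega
    · rw [excessVariation_succ_apply, hm, Finset.sum_range_succ, hsum]
      congr 1
      · refine Finset.sum_congr rfl fun j hj => ?_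
        have hj := Finset.mem_range.1 hj
        simp [hj.le, Nat.succ_le_iff.2 hj]
      · simp [hcr]

/-- On an optimal chain, jumps below `ε` contribute nothing and the others at most their size. -/
theorem excessVariation_le {S : ℕ → C(K, ℝ)} {ε : ℝ} (hε : 0 ≤ ε) {C : ℝ≥0} {k : K}
    (hC : ∀ n : ℕ → ℕ, StrictMono n → ∑' j : jumpSet S ε n k,
      ENNReal.ofReal |S (n (j + 1)) k - S (n j) k| ≤ (C : ℝ≥0∞)) (n : ℕ) :
    excessVariation S ε n k ≤ C := by
  obtain ⟨c, r, hc, -, hsum⟩ := exists_chain_excessVariation S ε k n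
  have h := hC c hc
  rw [tsum_subtype (jumpSet S ε c k) fun j => ENNReal.ofReal |S (c (j + 1)) k - S (c j) k|] at h
  have h' : ENNReal.ofReal (excessVariation S ε n k) ≤ C := by
    rw [hsum, ENNReal.ofReal_sum_of_nonneg fun _ _ => le_max_right _ _]
    refine le_trans (Finset.sum_le_sum fun j _ => ?_) ((ENNReal.sum_le_tsum _).trans h)
    by_cases hj : j ∈ jumpSet S ε c k
    · rw [Set.indicator_of_mem hj]
      exact ENNReal.ofReal_le_ofReal (max_le (by linarith) (abs_nonneg _))
    · rw [Set.indicator_of_notMem hj]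
      have : |S (c (j + 1)) k - S (c j) k| < ε := not_le.1 hj
      simp [max_eq_right (sub_nonpos.2 this.le)]
  exact (ENNReal.ofReal_le_coe).1 h'

theorem partialSups_continuousMap_apply (f : ℕ → C(K, ℝ)) (n : ℕ) (k : K) :
    partialSups f n k = partialSups (fun m => f m k) n := by
  induction n with
  | zero => simp
  | succ n ih => rw [partialSups_add_one, partialSups_add_one, ContinuousMap.sup_apply, ih]

/-- A difference of two bounded increasing sequences of continuous functions that start at `0`
converges to a function whose variation is controlled by their bounds. -/
theorem exists_hasVariationBound_of_monotone {A W : ℕ → C(K, ℝ)} (hA0 : A 0 = 0) (hW0 : W 0 = 0)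
    (hA : ∀ k, Monotone fun n => A n k) (hW : ∀ k, Monotone fun n => W n k) {a b : ℝ≥0}
    (ha : ∀ n k, A n k ≤ a) (hb : ∀ n k, W n k ≤ b) :
    ∃ G : K → ℝ, HasVariationBound G (a + b) ∧
      ∀ k, Tendsto (fun n => A n k - W n k) atTop (𝓝 (G k)) := by
  have hlim : ∀ k, Tendsto (fun n => A n k - W n k) atTop (𝓝 ((⨆ n, A n k) - ⨆ n, W n k)) :=
    fun k => (tendsto_atTop_ciSup (hA k) ⟨a, Set.forall_mem_range.2 fun n => ha n k⟩).sub
      (tendsto_atTop_ciSup (hW k) ⟨b, Set.forall_mem_range.2 fun n => hb n k⟩)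
  refine ⟨fun k => (⨆ n, A n k) - ⨆ n, W n k, ⟨fun n => A n - W n, by simp [hA0, hW0], hlim,
    fun k => ENNReal.tsum_le_of_sum_range_le fun N => ?_⟩, hlim⟩
  rw [← ENNReal.ofReal_sum_of_nonneg fun _ _ => abs_nonneg _, ENNReal.ofReal_le_coe]
  have hstep : ∀ n, |(A (n + 1) - W (n + 1)) k - (A n - W n) k| ≤
      (A (n + 1) k + W (n + 1) k) - (A n k + W n k) := fun n => by
    have h1 := hA k n.le_succ
    have h2 := hW k n.le_succ
    simp only [Nat.succ_eq_add_one, ContinuousMap.sub_apply] at h1 h2 ⊢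
    exact abs_le.2 ⟨by linarith, by linarith⟩
  refine (Finset.sum_le_sum fun n _ => hstep n).trans ?_
  rw [Finset.sum_range_sub fun n => A n k + W n k]
  have := ha N k
  have := hb N k
  simp only [hA0, hW0, ContinuousMap.zero_apply, NNReal.coe_add]
  linarith

theorem exists_hasVariationBound_of_jumps {F : K → ℝ} {C ε : ℝ≥0} {S : ℕ → C(K, ℝ)} (hS0 : S 0 = 0)
    (hSF : ∀ k, Tendsto (fun n => S n k) atTop (𝓝 (F k)))
    (hC : ∀ n : ℕ → ℕ, StrictMono n → ∀ k : K, ∑' j : jumpSet S ε n k,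
      ENNReal.ofReal |S (n (j + 1)) k - S (n j) k| ≤ (C : ℝ≥0∞)) :
    ∃ G : K → ℝ, HasVariationBound G (3 * C + 2 * ε) ∧ ∀ k, |F k - G k| ≤ ε := by
  have hε : (0 : ℝ) ≤ ε := ε.2
  set W := excessVariation S ε with hWdef
  have hW0 : W 0 = 0 := excessVariation_zero S ε
  have hWC : ∀ n k, W n k ≤ C := fun n k => excessVariation_le hε (fun c hc => hC c hc k) n
  have hosc : ∀ {m n : ℕ}, m ≤ n → ∀ k, |S n k - S m k| ≤ ε + (W n k - W m k) :=
    fun h k => abs_sub_le_excessVariation S hε h k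
  set A := fun n => partialSups (fun m => S m + W m) n with hAdef
  have hAapp : ∀ n k, A n k = partialSups (fun m => S m k + W m k) n :=
    fun n k => partialSups_continuousMap_apply _ n k
  have hle : ∀ n k, S n k + W n k ≤ A n k := fun n k => by
    rw [hAapp]
    exact le_partialSups (fun m => S m k + W m k) n
  have hge : ∀ n k, A n k ≤ S n k + W n k + ε := fun n k => by
    rw [hAapp]
    exact partialSups_le _ _ _ fun m hm => by linarith [(abs_le.1 (hosc hm k)).1]
  have hAb : ∀ n k, A n k ≤ (2 * C + 2 * ε : ℝ≥0) := fun n k => by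
    have h0 := (abs_le.1 (hosc n.zero_le k)).2
    simp only [hS0, hW0, ContinuousMap.zero_apply] at h0
    push_cast
    linarith [hge n k, hWC n k]
  obtain ⟨G, hG, hlim⟩ := exists_hasVariationBound_of_monotone (A := A) (W := W)
    (by simp [hAdef, hS0, hW0]) hW0
    (fun k m n h => by
      simp only [hAapp]
      exact (partialSups fun m => S m k + W m k).monotone h)
    (monotone_excessVariation S ε) hAb hWC
  refine ⟨G, by convert hG using 1; ring, fun k => ?_⟩
  refine le_of_tendsto ((hSF k).sub (hlim k)).abs (Eventually.of_forall fun n => ?_)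
  exact abs_le.2 ⟨by linarith [hge n k], by linarith [hle n k]⟩

theorem mem_baireQuarter_of_jumps {F : K → ℝ} (hF : F ∈ BaireOne K) {C : ℝ≥0}
    (h : ∀ ε : ℝ, 0 < ε → ∃ S : ℕ → C(K, ℝ), S 0 = 0 ∧
      (∀ k, Tendsto (fun n => S n k) atTop (𝓝 (F k))) ∧
      ∀ n : ℕ → ℕ, StrictMono n → ∀ k : K, ∑' j : jumpSet S ε n k,
        ENNReal.ofReal |S (n (j + 1)) k - S (n j) k| ≤ (C : ℝ≥0∞)) :
    F ∈ BaireQuarter K := by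
  have key : ∀ ε : ℝ≥0, 0 < ε →
      ∃ G : K → ℝ, HasVariationBound G (3 * C + 2 * ε) ∧ ∀ k, |F k - G k| ≤ ε := fun ε hε => by
    obtain ⟨S, hS0, hSF, hC⟩ := h ε (by exact_mod_cast hε)
    exact exists_hasVariationBound_of_jumps hS0 hSF hC
  choose G hG hFG using fun n : ℕ => key (1 / ((n : ℝ≥0) + 1)) (by positivity)
  refine ⟨hF, G, fun n => ⟨_, hG n⟩, ?_, 3 * C + 2, Set.forall_mem_range.2 fun n => ?_⟩
  · refine Metric.tendstoUniformly_iff.2 fun δ hδ => ?_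
    filter_upwards [(tendsto_one_div_add_atTop_nhds_zero_nat (𝕜 := ℝ)).eventually_lt_const hδ]
      with n hn k
    rw [Real.dist_eq]
    exact (hFG n k).trans_lt (by simpa using hn)
  · have hle : dbscNorm (G n) ≤ 3 * C + 2 * (1 / ((n : ℝ≥0) + 1)) :=
      csInf_le (OrderBot.bddBelow _) (hG n)
    refine hle.trans ?_
    have h1 : 1 / ((n : ℝ≥0) + 1) ≤ 1 := div_le_one_of_le₀ (by simp) (by simp)
    calc 3 * C + 2 * (1 / ((n : ℝ≥0) + 1)) ≤ 3 * C + 2 * 1 := by gcongr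
      _ = 3 * C + 2 := by ring

theorem tsum_edist_comp_strictMono_le {X : Type*} [PseudoEMetricSpace X] (u : ℕ → X) {n : ℕ → ℕ}
    (hn : StrictMono n) :
    ∑' j, edist (u (n j)) (u (n (j + 1))) ≤ ∑' i, edist (u i) (u (i + 1)) := by
  refine ENNReal.tsum_le_of_sum_range_le fun N => ?_
  have h : ∑ j ∈ Finset.range N, edist (u (n j)) (u (n (j + 1))) ≤
      ∑ i ∈ Finset.Ico 0 (n N), edist (u i) (u (i + 1)) := by
    induction N with
    | zero => simp
    | succ N ih =>
      rw [Finset.sum_range_succ,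
        ← Finset.sum_Ico_consecutive _ (n N).zero_le (hn N.lt_succ_self).le]
      exact add_le_add ih (edist_le_Ico_sum_edist u (hn N.lt_succ_self).le)
  exact h.trans (ENNReal.sum_le_tsum _)

/-- A Baire-1 function within `δ` of the limit of `(gₙ)` is the limit of continuous functions within
`δ` of `gₙ`. -/
theorem exists_tendsto_of_abs_sub_le {F G : K → ℝ} (hF : F ∈ BaireOne K) {δ : ℝ}
    (hFG : ∀ k, |F k - G k| ≤ δ) {g : ℕ → C(K, ℝ)} (hg0 : g 0 = 0) (hδ : 0 ≤ δ)
    (hg : ∀ k, Tendsto (fun n => g n k) atTop (𝓝 (G k))) :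
    ∃ S : ℕ → C(K, ℝ), S 0 = 0 ∧ (∀ k, Tendsto (fun n => S n k) atTop (𝓝 (F k))) ∧
      ∀ n k, |S n k - g n k| ≤ δ := by
  obtain ⟨f, -, hf⟩ := hF
  let h : ℕ → C(K, ℝ) := fun n =>
    ContinuousMap.const K (-δ) ⊔ (ContinuousMap.const K δ ⊓ (f n - g n))
  have happ : ∀ n k, h n k = max (-δ) (min δ (f n k - g n k)) := fun n k => rfl
  refine ⟨fun n => if n = 0 then 0 else g n + h n, by simp, fun k => ?_, fun n k => ?_⟩
  · have hlim : Tendsto (fun n => g n k + max (-δ) (min δ (f n k - g n k))) atTop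
        (𝓝 (G k + max (-δ) (min δ (F k - G k)))) :=
      (hg k).add (tendsto_const_nhds.max (tendsto_const_nhds.min ((hf k).sub (hg k))))
    rw [min_eq_right (abs_le.1 (hFG k)).2, max_eq_right (abs_le.1 (hFG k)).1,
      add_sub_cancel] at hlim
    refine hlim.congr' ?_
    filter_upwards [eventually_ne_atTop 0] with n hn
    simp [hn, happ]
  · rcases eq_or_ne n 0 with rfl | hn
    · simpa [hg0] using hδ
    · simp only [hn, if_false, ContinuousMap.add_apply, add_sub_cancel_left, happ]
      exact abs_le.2 ⟨le_max_left _ _, max_le (by linarith) (min_le_left _ _)⟩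

theorem tsum_jumpSet_le {S g : ℕ → C(K, ℝ)} {ε : ℝ} {C : ℝ≥0} {k : K}
    (hSg : ∀ n, |S n k - g n k| ≤ ε / 4)
    (hg : ∑' n, ENNReal.ofReal |g (n + 1) k - g n k| ≤ (C : ℝ≥0∞)) {n : ℕ → ℕ}
    (hn : StrictMono n) :
    ∑' j : jumpSet S ε n k, ENNReal.ofReal |S (n (j + 1)) k - S (n j) k| ≤
      ((2 * C : ℝ≥0) : ℝ≥0∞) := by
  have hed : ∀ a b : ℝ, ENNReal.ofReal |b - a| = edist a b := fun a b => by
    rw [edist_comm, edist_dist, Real.dist_eq]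
  calc ∑' j : jumpSet S ε n k, ENNReal.ofReal |S (n (j + 1)) k - S (n j) k|
      ≤ ∑' j : jumpSet S ε n k, 2 * edist (g (n j) k) (g (n (j + 1)) k) := by
        refine ENNReal.tsum_le_tsum fun j => ?_
        have hj : ε ≤ |S (n (j + 1)) k - S (n j) k| := j.2
        have h1 := abs_le.1 (hSg (n j))
        have h2 := abs_le.1 (hSg (n (j + 1)))
        rw [← hed, ← ENNReal.ofReal_ofNat 2, ← ENNReal.ofReal_mul zero_le_two]
        refine ENNReal.ofReal_le_ofReal ?_
        have h3 : |S (n (j + 1)) k - S (n j) k| ≤ |g (n (j + 1)) k - g (n j) k| + ε / 2 :=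
          abs_le.2 ⟨by linarith [neg_abs_le (g (n (j + 1)) k - g (n j) k)],
            by linarith [le_abs_self (g (n (j + 1)) k - g (n j) k)]⟩
        -- As the jump of `S` is at least `ε`, the error `ε / 2` is at most half of it and can be
        -- absorbed; hence the factor `2`.
        linarith
    _ ≤ ∑' j, 2 * edist (g (n j) k) (g (n (j + 1)) k) :=
        ENNReal.tsum_comp_le_tsum_of_injective Subtype.val_injective _
    _ = 2 * ∑' j, edist (g (n j) k) (g (n (j + 1)) k) := ENNReal.tsum_mul_left
    _ ≤ 2 * C := by
        gcongr
        refine (tsum_edist_comp_strictMono_le (fun i => g i k) hn).trans ?_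
        simpa only [hed] using hg
    _ = ((2 * C : ℝ≥0) : ℝ≥0∞) := by push_cast; rfl

theorem exists_jumps_bound_of_mem_baireQuarter {F : K → ℝ} (hF : F ∈ BaireQuarter K) :
    ∃ C : ℝ≥0, ∀ ε : ℝ, 0 < ε → ∃ S : ℕ → C(K, ℝ), S 0 = 0 ∧
      (∀ k, Tendsto (fun n => S n k) atTop (𝓝 (F k))) ∧
      ∀ n : ℕ → ℕ, StrictMono n → ∀ k : K, ∑' j : jumpSet S ε n k,
        ENNReal.ofReal |S (n (j + 1)) k - S (n j) k| ≤ (C : ℝ≥0∞) := by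
  obtain ⟨hF1, G, hG, hGF, M, hM⟩ := hF
  refine ⟨2 * (M + 1), fun ε hε => ?_⟩
  obtain ⟨N, hN⟩ := (Metric.tendstoUniformly_iff.1 hGF (ε / 4) (by positivity)).exists
  -- The infimum need not be attained, so `1` is added to leave room for an actual variation bound.
  have hlt : dbscNorm (G N) < M + 1 :=
    (hM (Set.mem_range_self N)).trans_lt (lt_add_of_pos_right M one_pos)
  obtain ⟨C, ⟨g, hg0, hgG, hgC⟩, hCM⟩ := exists_lt_of_csInf_lt (hG N) hlt
  obtain ⟨S, hS0, hSF, hSg⟩ := exists_tendsto_of_abs_sub_le hF1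
    (fun k => (hN k).le) hg0 (by positivity) hgG
  exact ⟨S, hS0, hSF, fun n hn k => tsum_jumpSet_le (fun n => hSg n k)
    ((hgC k).trans (by exact_mod_cast hCM.le)) hn⟩

end Variation

theorem theorem6p1 {K : Type*} [MetricSpace K] [CompactSpace K] (F : K → ℝ)
    (hF : F ∈ BaireOne K) :
    F ∈ BaireQuarter K ↔
      ∃ C : ℝ≥0, ∀ ε : ℝ, 0 < ε →
        ∃ S : ℕ → C(K, ℝ), S 0 = 0 ∧
          (∀ k, Tendsto (fun n => S n k) atTop (𝓝 (F k))) ∧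
          ∀ n : ℕ → ℕ, StrictMono n → ∀ k : K,
            ∑' j : jumpSet S ε n k,
              ENNReal.ofReal |S (n (j + 1)) k - S (n j) k| ≤ (C : ℝ≥0∞) := by
  exact ⟨exists_jumps_bound_of_mem_baireQuarter, fun ⟨_, h⟩ => mem_baireQuarter_of_jumps hF h⟩
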